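/- Let $k,p\ge 0$ be integers and let $M,\tau,H_p$ be real numbers with $H_p\ge 0$. Let $\phi:\mathbb R^p\to\mathbb R$ be convex and differentiable, with Bregman divergence $d_\phi(x,y)=\phi(x)-\phi(y)-\langle\nabla\phi(y),x-y\rangle$, and assume $\|\nabla\phi(x)-\nabla\phi(y)\|_2\le H_p\|x-y\|_2$ for all $x,y\in[-M,M]^p$. Let $\Psi:\mathbb R_{\ge 0}^k\to\mathbb R_{\ge 0}$ be componentwise non-decreasing with $\Psi(0)=0$ and $|\Psi(x)-\Psi(y)|\le\tau\|x-y\|_1$ for all $x,y\in\mathbb R_{\ge0}^k$. For $\Theta=(\theta_1,\dots,\theta_k)\in\mathbb R^{k\times p}$ put $f_\Theta(x)=\Psi\big(d_\phi(x,\theta_1),\dots,d_\phi(x,\theta_k)\big)$. Let $P$ be a probability measure on $\mathbb R^p$ with $P([-M,M]^p)=1$, and write $Pf=\int f\,dP$. Let $X_1,\dots,X_n$ be random vectors in $\mathbb R^p$ on a common probability space, and let $\{1,\dots,n\}=\mathcal I\sqcup\mathcal O$ be a fixed partition such that $(X_i)_{i\in\mathcal I}$ (the inliers) are i.i.d. with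 law $P$; nothing is assumed about the distribution or the dependence of the outliers $(X_i)_{i\in\mathcal O}$. Let $\{1,\dots,n\}$ be partitioned into $L$ blocks $B_1,\dots,B_L$ of equal size $b\ge1$ (so $n=Lb$), the partition being deterministic, and put $$\mathrm{MoM}_L^n(f_\Theta)=\mathrm{Median}\Big(\tfrac1b\sum_{i\in B_1}f_\Theta(X_i),\dots,\tfrac1b\sum_{i\in B_L}f_\Theta(X_i)\Big),$$ where for even $L$ the median is the average of the two middle values. Let $\eta>0$ be such that $L>(2+\eta)|\mathcal O|$, and set $\delta=\frac{2}{4+\eta}-\frac{|\mathcal O|}{L}$. Then there is a constant $C_\eta>0$, depending only on $\eta$, such that with probability at least $1-2e^{-2L\delta^2}$, $$\sup_{\Theta\in[-M,M]^{k\times p}}\big|\mathrm{MoM}_L^n(f_\Theta)-Pf_\Theta\big|\le C_\eta\,M^2\,\tau\,H_p\,\max\Big\{kp\sqrt{\tfrac Ln},\ (kp)^{3/2}\,\tfrac{\sqrt{|\mathcal I|}}{n}\Big\}.$$ -/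

import Mathlib

open MeasureTheory ProbabilityTheory

noncomputable section

/-- The cube `[-M, M]^p` in Euclidean space `ℝ^p`. -/
def box (p : ℕ) (M : ℝ) : Set (EuclideanSpace ℝ (Fin p)) :=
  {x | ∀ i, x i ∈ Set.Icc (-M) M}

/-- The set `[-M, M]^{k × p}` of centroid matrices; the rows `Θ 0, …, Θ (k - 1)` are the
centroids. -/
def centroidBox (k p : ℕ) (M : ℝ) : Set (Fin k → EuclideanSpace ℝ (Fin p)) :=
  {Θ | ∀ j, Θ j ∈ box p M}

/-- The Bregman divergence `d_φ(x, y) = φ(x) - φ(y) - ⟨∇φ(y), x - y⟩`. -/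
def bregmanDiv {p : ℕ} (φ : EuclideanSpace ℝ (Fin p) → ℝ) (x y : EuclideanSpace ℝ (Fin p)) : ℝ :=
  φ x - φ y - inner ℝ (gradient φ y) (x - y)

/-- The clustering loss `f_Θ(x) = Ψ(d_φ(x, θ_1), …, d_φ(x, θ_k))`. -/
def clusterLoss {k p : ℕ} (Ψ : (Fin k → ℝ) → ℝ) (φ : EuclideanSpace ℝ (Fin p) → ℝ)
    (Θ : Fin k → EuclideanSpace ℝ (Fin p)) (x : EuclideanSpace ℝ (Fin p)) : ℝ :=
  Ψ (fun j => bregmanDiv φ x (Θ j))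

/-- The sample median of `L` real numbers: with the values in non-decreasing order
`v_(1) ≤ … ≤ v_(L)`, it is `v_((L+1)/2)` if `L` is odd and the average of `v_(L/2)` and
`v_(L/2+1)` if `L` is even (positions below count from zero). -/
def sampleMedian {L : ℕ} (v : Fin L → ℝ) : ℝ :=
  if h : 0 < L then
    (v (Tuple.sort v ⟨(L - 1) / 2, by omega⟩) + v (Tuple.sort v ⟨L / 2, by omega⟩)) / 2
  else 0

/-- The blocks `B 0, …, B (L - 1)` partition the `n` sample indices, and each contains exactly
`b` of them (so that `n = L * b`). -/
structure IsBlockPartition {n L : ℕ} (B : Fin L → Finset (Fin n)) (b : ℕ) : Prop where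
  card_eq : ∀ ℓ, (B ℓ).card = b
  disjoint : ∀ ℓ ℓ', ℓ ≠ ℓ' → Disjoint (B ℓ) (B ℓ')
  cover : ∀ i, ∃ ℓ, i ∈ B ℓ

/-- The median-of-means estimate of the mean of `f` from the sample `x`: the median over the
blocks of the averages of `f` over each block. -/
def medianOfMeans {n L : ℕ} {E : Type*} (B : Fin L → Finset (Fin n)) (b : ℕ) (f : E → ℝ)
    (x : Fin n → E) : ℝ :=
  sampleMedian (fun ℓ => (1 / (b : ℝ)) * ∑ i ∈ B ℓ, f (x i))

end

/-!
Boundedness of the loss makes a direct union bound strong enough for the uniform deviation of the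
median of means.

Write `K = M² τ H k p`. The first-order inequality for convex functions gives
`0 ≤ d_φ(x, θ) ≤ ⟨∇φ(x) - ∇φ(θ), x - θ⟩`, and
`d_φ(x, θ) - d_φ(x, θ') = d_φ(θ', θ) + ⟨∇φ(θ') - ∇φ(θ), x - θ'⟩`. Hence on the cube the loss is
bounded by `8 K`, and it changes by at most `8 K s` when every coordinate of every centroid moves
by at most `2 M s` (`abs_clusterLoss_le`, `abs_clusterLoss_sub_le`). Grids of mesh `2 M / 2 ^ m`
are therefore `8 K / 2 ^ m`-nets in the sup norm, of size at most `(2 ^ m + 1) ^ (k p)`.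

For a function `h`, let `S(h)` be the sum over the blocks of `|∑ (h (X_i) - P h)|`, the inner sum
running over the inliers of the block (`blockDeviation`). `S` is a seminorm, and it is the maximum
over the `2 ^ L` choices of one sign per block of a signed sum of independent bounded variables.
Hoeffding's inequality and a union bound over the signs give
`ℙ(S(h) ≥ t) ≤ 2 ^ L exp(-t² / (2 |I| r²))` if `|h| ≤ r` on the cube, where `I` is the set of
inliers (`measureReal_blockDeviation_ge_le`). Chaining along the grids, with thresholds
proportional to `(3 / 4) ^ m`, gives `S(f_Θ) ≤ u` for all `Θ` simultaneously outside an event of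
probability at most `exp(-L)`, as soon as `u²` is at least a constant times `|I| K² (L + k p)`
(`measureReal_not_forall_blockDeviation_le`).

Take `u = c n ε` with `ε` the claimed error bound and `c = η / (2 (2 + η))`. Then at most `c L`
blocks without outliers have a mean that is off by more than `ε`. Together with the at most `|O|`
blocks that contain outliers these are fewer than `L / 2`, and the median is within `ε` of `P f_Θ`
(`abs_medianOfMeans_sub_integral_le`). Since `δ ≤ 1 / 2`, the probability `exp(-L)` is below
`2 exp(-2 L δ²)`. The two terms of the maximum in the error bound are what the two summands of
`L + k p` require (`chaining_condition_of_max`). If `K = 0`, the loss vanishes on the cube and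
`S(f_Θ) = 0` almost surely for all `Θ`, so the same argument applies with every `ε > 0`.
-/

/-! ### Deviations summed over blocks -/

/-- The deviations from the mean of `h` under `P`, summed inside each block and then added up in
absolute value over the blocks; `blk i` is the block of the sample point `x i`. -/
noncomputable def blockDeviation {ι E : Type*} [Fintype ι] [MeasurableSpace E] {L : ℕ}
    (P : Measure E) (blk : ι → Fin L) (x : ι → E) (h : E → ℝ) : ℝ :=
  ∑ ℓ, |∑ i with blk i = ℓ, (h (x i) - ∫ y, h y ∂P)|

theorem blockDeviation_add_le {ι E : Type*} [Fintype ι] [MeasurableSpace E] {L : ℕ}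
    {P : Measure E} (blk : ι → Fin L) (x : ι → E) {g h : E → ℝ}
    (hg : Integrable g P) (hh : Integrable h P) :
    blockDeviation P blk x (fun y => g y + h y) ≤
      blockDeviation P blk x g + blockDeviation P blk x h := by
  unfold blockDeviation
  rw [← Finset.sum_add_distrib]
  refine Finset.sum_le_sum fun ℓ _ => ?_
  rw [integral_add hg hh]
  refine le_trans (le_of_eq ?_) (abs_add_le _ _)
  rw [← Finset.sum_add_distrib]
  congr 1
  exact Finset.sum_congr rfl fun i _ => by ring

theorem blockDeviation_le_of_abs_le {ι E : Type*} [Fintype ι] [MeasurableSpace E] {L : ℕ}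
    {P : Measure E} [IsProbabilityMeasure P] (blk : ι → Fin L) (x : ι → E) {h : E → ℝ} {r : ℝ}
    {D : Set E} (hD : ∀ᵐ y ∂P, y ∈ D) (hr : ∀ y ∈ D, |h y| ≤ r) (hx : ∀ i, x i ∈ D) :
    blockDeviation P blk x h ≤ 2 * Fintype.card ι * r := by
  have hint : |∫ y, h y ∂P| ≤ r := by
    have := norm_integral_le_of_norm_le_const (μ := P) (f := h) (C := r)
      (hD.mono fun y hy => by simpa using hr y hy)
    simpa using this
  have hterm : ∀ i, |h (x i) - ∫ y, h y ∂P| ≤ 2 * r := fun i =>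
    (abs_sub _ _).trans (by linarith [hr _ (hx i)])
  calc blockDeviation P blk x h
      ≤ ∑ ℓ, ∑ i with blk i = ℓ, |h (x i) - ∫ y, h y ∂P| :=
        Finset.sum_le_sum fun ℓ _ => Finset.abs_sum_le_sum_abs _ _
    _ = ∑ i, |h (x i) - ∫ y, h y ∂P| := Finset.sum_fiberwise _ _ _
    _ ≤ ∑ _i : ι, 2 * r := Finset.sum_le_sum fun i _ => hterm i
    _ = 2 * Fintype.card ι * r := by simp; ring

/-- A sum of absolute values is attained by one choice of signs, here encoded by the set of blocks
that carry the sign `+`. -/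
theorem exists_signs_blockDeviation_eq {ι E : Type*} [Fintype ι] [MeasurableSpace E] {L : ℕ}
    (P : Measure E) (blk : ι → Fin L) (x : ι → E) (h : E → ℝ) :
    ∃ s : Finset (Fin L), blockDeviation P blk x h =
      ∑ i, (if blk i ∈ s then (1 : ℝ) else -1) * (h (x i) - ∫ y, h y ∂P) := by
  refine ⟨Finset.univ.filter fun ℓ => 0 ≤ ∑ i with blk i = ℓ, (h (x i) - ∫ y, h y ∂P), ?_⟩
  rw [← Finset.sum_fiberwise (g := blk)]
  refine Finset.sum_congr rfl fun ℓ _ => ?_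
  by_cases hℓ : 0 ≤ ∑ i with blk i = ℓ, (h (x i) - ∫ y, h y ∂P)
  · rw [abs_of_nonneg hℓ]
    refine Finset.sum_congr rfl fun i hi => ?_
    rw [(Finset.mem_filter.1 hi).2, if_pos (by simpa using hℓ), one_mul]
  · rw [abs_of_neg (not_le.1 hℓ), ← Finset.sum_neg_distrib]
    refine Finset.sum_congr rfl fun i hi => ?_
    rw [(Finset.mem_filter.1 hi).2, if_neg (by simpa using hℓ), neg_one_mul]

/-- Hoeffding's inequality for a fixed choice of signs. -/
theorem measureReal_signed_sum_ge_le {ι E Ω : Type*} [Fintype ι] [MeasurableSpace E]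
    [MeasurableSpace Ω] {P : Measure E} [IsProbabilityMeasure P] {μ : Measure Ω}
    [IsProbabilityMeasure μ] {X : ι → Ω → E} (hXm : ∀ i, Measurable (X i))
    (hind : iIndepFun X μ) (hlaw : ∀ i, μ.map (X i) = P) {h : E → ℝ} (hm : Measurable h) {r : ℝ}
    (hr : ∀ᵐ y ∂P, |h y| ≤ r) (s : ι → Prop) [DecidablePred s] {t : ℝ} (ht : 0 ≤ t) :
    μ.real {ω | t ≤ ∑ i, (if s i then (1 : ℝ) else -1) * (h (X i ω) - ∫ y, h y ∂P)} ≤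
      Real.exp (-t ^ 2 / (2 * Fintype.card ι * r ^ 2)) := by
  have hr0 : 0 ≤ r := by
    obtain ⟨y, hy⟩ := hr.exists
    exact (abs_nonneg _).trans hy
  have hsub : ∀ i, HasSubgaussianMGF (fun ω => h (X i ω) - ∫ y, h y ∂P)
      ((‖r - -r‖₊ / 2) ^ 2) μ := by
    intro i
    have hmean : ∫ y, h y ∂P = ∫ ω, h (X i ω) ∂μ := by
      rw [← hlaw i, integral_map (hXm i).aemeasurable hm.aestronglyMeasurable]
    rw [hmean]
    refine hasSubgaussianMGF_of_mem_Icc (hm.comp (hXm i)).aemeasurable ?_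
    have := hr
    rw [← hlaw i] at this
    filter_upwards [ae_of_ae_map (hXm i).aemeasurable this] with ω hω using abs_le.1 hω
  have hc : ((‖r - -r‖₊ / 2) ^ 2 : NNReal) = (r ^ 2).toNNReal := by
    ext
    push_cast
    rw [Real.norm_eq_abs, abs_of_nonneg (by linarith), Real.coe_toNNReal _ (sq_nonneg r)]
    ring
  rw [hc] at hsub
  have hsub' : ∀ i ∈ Finset.univ, HasSubgaussianMGF
      (fun ω => (if s i then (1 : ℝ) else -1) * (h (X i ω) - ∫ y, h y ∂P))
      (r ^ 2).toNNReal μ := by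
    intro i _
    by_cases hs : s i
    · simpa [hs] using hsub i
    · simpa [hs, Pi.neg_def] using (hsub i).neg
  have hind' : iIndepFun
      (fun i ω => (if s i then (1 : ℝ) else -1) * (h (X i ω) - ∫ y, h y ∂P)) μ :=
    hind.comp (fun i y => (if s i then (1 : ℝ) else -1) * (h y - ∫ y, h y ∂P))
      (fun i => (hm.sub_const _).const_mul _)
  refine (HasSubgaussianMGF.measure_sum_ge_le_of_iIndepFun hind' hsub' ht).trans (le_of_eq ?_)
  have hsum : ((∑ _i : ι, (r ^ 2).toNNReal : NNReal) : ℝ) = Fintype.card ι * r ^ 2 := by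
    rw [Finset.sum_const, Finset.card_univ, nsmul_eq_mul, NNReal.coe_mul, NNReal.coe_natCast,
      Real.coe_toNNReal _ (sq_nonneg r)]
  rw [hsum, mul_assoc]

/-- The union bound over the `2 ^ L` choices of signs. -/
theorem measureReal_blockDeviation_ge_le {ι E Ω : Type*} [Fintype ι] [MeasurableSpace E]
    [MeasurableSpace Ω] {L : ℕ} {P : Measure E} [IsProbabilityMeasure P] {μ : Measure Ω}
    [IsProbabilityMeasure μ] {X : ι → Ω → E} (hXm : ∀ i, Measurable (X i))
    (hind : iIndepFun X μ) (hlaw : ∀ i, μ.map (X i) = P) (blk : ι → Fin L)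
    {h : E → ℝ} (hm : Measurable h) {r : ℝ}
    (hr : ∀ᵐ y ∂P, |h y| ≤ r) {t : ℝ} (ht : 0 ≤ t) :
    μ.real {ω | t ≤ blockDeviation P blk (fun i => X i ω) h} ≤
      2 ^ L * Real.exp (-t ^ 2 / (2 * Fintype.card ι * r ^ 2)) := by
  have hsub : {ω | t ≤ blockDeviation P blk (fun i => X i ω) h} ⊆
      ⋃ s ∈ (Finset.univ : Finset (Finset (Fin L))),
        {ω | t ≤ ∑ i, (if blk i ∈ s then (1 : ℝ) else -1) * (h (X i ω) - ∫ y, h y ∂P)} := by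
    intro ω hω
    obtain ⟨s, hs⟩ := exists_signs_blockDeviation_eq P blk (fun i => X i ω) h
    simp only [Set.mem_iUnion]
    exact ⟨s, Finset.mem_univ _, by rwa [Set.mem_ofPred_eq, hs] at hω⟩
  calc _ ≤ μ.real (⋃ s ∈ (Finset.univ : Finset (Finset (Fin L))),
        {ω | t ≤ ∑ i, (if blk i ∈ s then (1 : ℝ) else -1) * (h (X i ω) - ∫ y, h y ∂P)}) :=
        measureReal_mono hsub (measure_ne_top _ _)
    _ ≤ ∑ s : Finset (Fin L), _ := measureReal_biUnion_finset_le _ _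
    _ ≤ ∑ _s : Finset (Fin L), Real.exp (-t ^ 2 / (2 * Fintype.card ι * r ^ 2)) :=
        Finset.sum_le_sum fun s _ => measureReal_signed_sum_ge_le hXm hind hlaw hm hr _ ht
    _ = _ := by simp

/-! ### Chaining -/

theorem two_pow_le_exp (n : ℕ) : (2 : ℝ) ^ n ≤ Real.exp n := by
  have h : (2 : ℝ) ≤ Real.exp 1 := by linarith [Real.add_one_le_exp (1 : ℝ)]
  calc (2 : ℝ) ^ n ≤ Real.exp 1 ^ n := by gcongr
    _ = Real.exp n := by rw [← Real.exp_nat_mul, mul_one]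

/-- The union bound over the links of level `m`: the links have size `3 R / 2 ^ m`, and the
threshold `(3 / 4) ^ m u / 4` decays more slowly, so that the exponent grows at least linearly in
`m` and beats the number of links. The constant `1152 = 4 * 288` makes the exponent of Hoeffding's
inequality, `(9 / 4) ^ m u² / (288 |ι| R²)`, at least `4 (m + 1) (L + d)`. -/
theorem measureReal_exists_link_ge_le {ι E Ω κ : Type*} [Fintype ι] [MeasurableSpace E]
    [MeasurableSpace Ω] {L : ℕ} {P : Measure E} [IsProbabilityMeasure P] {μ : Measure Ω}
    [IsProbabilityMeasure μ] {X : ι → Ω → E} (hXm : ∀ i, Measurable (X i))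
    (hind : iIndepFun X μ) (hlaw : ∀ i, μ.map (X i) = P) (blk : ι → Fin L)
    (hι : 0 < Fintype.card ι) {D : Set E} (hD : ∀ᵐ y ∂P, y ∈ D) {R u : ℝ} (hR : 0 < R)
    (hu : 0 ≤ u) {d m : ℕ} (hu2 : 1152 * Fintype.card ι * R ^ 2 * (L + d) ≤ u ^ 2)
    {g : κ → E → ℝ} (hg : ∀ a, Measurable (g a)) {F : Finset κ}
    (hF : F.card ≤ ((2 ^ m + 1) ^ d) ^ 2)
    (hgF : ∀ a ∈ F, ∀ y ∈ D, |g a y| ≤ 3 * R * (1 / 2) ^ m) :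
    μ.real (⋃ a ∈ F, {ω | (3 / 4) ^ m / 4 * u ≤ blockDeviation P blk (fun i => X i ω) (g a)}) ≤
      Real.exp (-3 * L * (m + 1)) := by
  set N : ℝ := (Fintype.card ι : ℝ) with hN
  have hNpos : 0 < N := by rw [hN]; exact_mod_cast hι
  have hexp : -((3 / 4) ^ m / 4 * u) ^ 2 / (2 * N * (3 * R * (1 / 2) ^ m) ^ 2) ≤
      -(4 * (m + 1) * (L + d)) := by
    rw [neg_div, neg_le_neg_iff, le_div_iff₀ (by positivity)]
    have hbern : (m : ℝ) + 1 ≤ (9 / 4) ^ m := by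
      have := one_add_mul_le_pow (a := (5 / 4 : ℝ)) (by norm_num) m
      norm_num at this
      have hm : (0 : ℝ) ≤ m := m.cast_nonneg
      linarith
    have h9 : ((3 / 4 : ℝ) ^ m) ^ 2 = (9 / 4) ^ m * ((1 / 2) ^ m) ^ 2 := by
      rw [← pow_mul, ← pow_mul, mul_comm m 2, pow_mul, pow_mul, ← mul_pow]
      norm_num
    calc 4 * ((m : ℝ) + 1) * (L + d) * (2 * N * (3 * R * (1 / 2) ^ m) ^ 2)
        = ((m + 1) * ((1 / 2) ^ m) ^ 2) * (1152 * N * R ^ 2 * (L + d)) / 16 := by ring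
      _ ≤ ((9 / 4) ^ m * ((1 / 2) ^ m) ^ 2) * u ^ 2 / 16 := by gcongr
      _ = ((3 / 4) ^ m / 4 * u) ^ 2 := by rw [← h9]; ring
  have hcard : (F.card : ℝ) ≤ Real.exp (2 * (m + 1) * d) := by
    have h1 : (F.card : ℝ) ≤ (((2 : ℝ) ^ m + 1) ^ d) ^ 2 := by exact_mod_cast hF
    have h2 : (2 : ℝ) ^ m + 1 ≤ 2 ^ (m + 1) := by
      have := one_le_pow₀ (n := m) (one_le_two (α := ℝ))
      rw [pow_succ]
      linarith
    calc (F.card : ℝ) ≤ (((2 : ℝ) ^ (m + 1)) ^ d) ^ 2 := h1.trans (by gcongr)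
      _ = 2 ^ ((m + 1) * d * 2) := by rw [← pow_mul, ← pow_mul, mul_assoc]
      _ ≤ _ := (two_pow_le_exp _).trans (le_of_eq (by push_cast; ring_nf))
  calc _ ≤ ∑ a ∈ F, μ.real
        {ω | (3 / 4) ^ m / 4 * u ≤ blockDeviation P blk (fun i => X i ω) (g a)} :=
        measureReal_biUnion_finset_le _ _
    _ ≤ ∑ _a ∈ F, Real.exp L * Real.exp (-(4 * (m + 1) * (L + d))) := by
        refine Finset.sum_le_sum fun a ha => ?_
        refine (measureReal_blockDeviation_ge_le hXm hind hlaw blk (hg a)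
          (hD.mono (hgF a ha)) (by positivity)).trans ?_
        gcongr
        exact two_pow_le_exp L
    _ = F.card * (Real.exp L * Real.exp (-(4 * (m + 1) * (L + d)))) := by simp
    _ ≤ Real.exp (2 * (m + 1) * d) * (Real.exp L * Real.exp (-(4 * (m + 1) * (L + d)))) := by
        gcongr
    _ = Real.exp (2 * (m + 1) * d + (L + -(4 * (m + 1) * (L + d)))) := by
        rw [Real.exp_add, Real.exp_add]
    _ ≤ _ := by
        refine Real.exp_le_exp.2 ?_
        have h1 : (0 : ℝ) ≤ m * L := by positivity
        have h2 : (0 : ℝ) ≤ m * d := by positivity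
        have h3 : (0 : ℝ) ≤ d := by positivity
        linarith

/-- The chaining bound: for a family with dyadic nets of size `(2 ^ m + 1) ^ d`, the summed block
deviations stay below `u` uniformly over the family, up to probability `exp (-L)`. -/
theorem measureReal_not_forall_blockDeviation_le {ι E Ω T : Type*} [Fintype ι] [MeasurableSpace E]
    [MeasurableSpace Ω] {L : ℕ} {P : Measure E} [IsProbabilityMeasure P] {μ : Measure Ω}
    [IsProbabilityMeasure μ] {X : ι → Ω → E} (hXm : ∀ i, Measurable (X i))
    (hind : iIndepFun X μ) (hlaw : ∀ i, μ.map (X i) = P) (blk : ι → Fin L)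
    (hι : 0 < Fintype.card ι) {D : Set E} (hD : ∀ᵐ y ∂P, y ∈ D) {R u : ℝ} (hR : 0 < R)
    (hu : 0 ≤ u) {d : ℕ} (hu2 : 1152 * Fintype.card ι * R ^ 2 * (L + d) ≤ u ^ 2)
    {f : T → E → ℝ} (hfm : ∀ t, Measurable (f t)) (hfR : ∀ t, ∀ y ∈ D, |f t y| ≤ R)
    (hnet : ∀ m : ℕ, ∃ N : Finset T, N.card ≤ (2 ^ m + 1) ^ d ∧
      ∀ t, ∃ v ∈ N, ∀ y ∈ D, |f t y - f v y| ≤ R * (1 / 2) ^ m) :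
    μ.real {ω | ¬ ∀ t, blockDeviation P blk (fun i => X i ω) (f t) ≤ u} ≤ Real.exp (-L) := by
  classical
  have hL : 1 ≤ (L : ℝ) := by
    obtain ⟨i⟩ := Fintype.card_pos_iff.1 hι
    exact_mod_cast Nat.one_le_iff_ne_zero.2 fun h => (h ▸ blk i : Fin 0).elim0
  choose N hNcard π hπN hπ using hnet
  have hfint : ∀ t, Integrable (f t) P := fun t =>
    Integrable.of_bound (hfm t).aestronglyMeasurable R (hD.mono fun y hy => hfR t y hy)
  -- the links of level `0` are the net functions themselves
  let g : ℕ → T × T → E → ℝ := fun m a => if m = 0 then f a.1 else fun y => f a.1 y - f a.2 y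
  have hgm : ∀ m a, Measurable (g m a) := by
    intro m a
    by_cases hm : m = 0
    · simpa [g, hm] using hfm a.1
    · simp only [g, hm, if_false]
      exact (hfm a.1).sub (hfm a.2)
  let F : ℕ → Finset (T × T) := fun m =>
    (N m ×ˢ N (m - 1)).filter fun a => ∀ y ∈ D, |g m a y| ≤ 3 * R * (1 / 2) ^ m
  have hFcard : ∀ m, (F m).card ≤ ((2 ^ m + 1) ^ d) ^ 2 := by
    intro m
    refine (Finset.card_filter_le _ _).trans ?_
    rw [Finset.card_product, sq]
    refine Nat.mul_le_mul (hNcard m) ((hNcard (m - 1)).trans ?_)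
    gcongr
    · norm_num
    · omega
  let Bad : ℕ → Set Ω := fun m =>
    ⋃ a ∈ F m, {ω | (3 / 4) ^ m / 4 * u ≤ blockDeviation P blk (fun i => X i ω) (g m a)}
  have hBad : ∀ m, μ (Bad m) ≤ ENNReal.ofReal (Real.exp (-L) * (1 / 2) ^ (m + 1)) := by
    intro m
    rw [← ENNReal.ofReal_toReal (measure_ne_top μ (Bad m))]
    refine ENNReal.ofReal_le_ofReal ((measureReal_exists_link_ge_le hXm hind hlaw blk hι hD hR hu
      hu2 (hgm m) (hFcard m) (fun a ha => (Finset.mem_filter.1 ha).2)).trans ?_)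
    have h2 : Real.exp (-((m + 1 : ℕ) : ℝ)) ≤ (1 / 2) ^ (m + 1) := by
      rw [Real.exp_neg, one_div, inv_pow]
      exact inv_anti₀ (by positivity) (two_pow_le_exp _)
    calc Real.exp (-3 * L * (m + 1)) ≤ Real.exp (-L + -((m + 1 : ℕ) : ℝ)) := by
          refine Real.exp_le_exp.2 ?_
          push_cast
          have hm : (0 : ℝ) ≤ m := m.cast_nonneg
          nlinarith
      _ = Real.exp (-L) * Real.exp (-((m + 1 : ℕ) : ℝ)) := Real.exp_add _ _
      _ ≤ _ := by gcongr
  have hsum : HasSum (fun m : ℕ => Real.exp (-L) * (1 / 2 : ℝ) ^ (m + 1)) (Real.exp (-L)) := by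
    have := (hasSum_geometric_two.mul_left (1 / 2)).mul_left (Real.exp (-L))
    simpa [pow_succ, mul_comm, mul_left_comm] using this
  have hBadU : μ (⋃ m, Bad m) ≤ ENNReal.ofReal (Real.exp (-L)) := by
    refine (measure_iUnion_le _).trans ((ENNReal.tsum_le_tsum hBad).trans (le_of_eq ?_))
    rw [← ENNReal.ofReal_tsum_of_nonneg (fun m => by positivity) hsum.summable, hsum.tsum_eq]
  have hXD : ∀ᵐ ω ∂μ, ∀ i, X i ω ∈ D := by
    refine ae_all_iff.2 fun i => ?_
    have := hD
    rw [← hlaw i] at this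
    exact ae_of_ae_map (hXm i).aemeasurable this
  have hgood : ∀ ω, (∀ i, X i ω ∈ D) → ω ∉ ⋃ m, Bad m →
      ∀ t, blockDeviation P blk (fun i => X i ω) (f t) ≤ u := by
    intro ω hω hωB t
    set S : (E → ℝ) → ℝ := blockDeviation P blk (fun i => X i ω) with hS
    have hlink : ∀ m, ∀ a ∈ F m, S (g m a) ≤ (3 / 4) ^ m / 4 * u := by
      intro m a ha
      by_contra hcon
      refine hωB (Set.mem_iUnion.2 ⟨m, Set.mem_iUnion₂.2 ⟨a, ha, ?_⟩⟩)
      exact (not_le.1 hcon).le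
    have htel : ∀ m, S (f (π m t)) ≤ ∑ j ∈ Finset.range (m + 1), (3 / 4) ^ j / 4 * u := by
      intro m
      induction m with
      | zero =>
        have hmem : (π 0 t, π 0 t) ∈ F 0 := by
          refine Finset.mem_filter.2 ⟨Finset.mk_mem_product (hπN 0 t) (hπN 0 t), fun y hy => ?_⟩
          have := hfR (π 0 t) y hy
          simp only [g, if_true, pow_zero]
          linarith
        simpa [g] using hlink 0 _ hmem
      | succ m ih =>
        have hmem : (π (m + 1) t, π m t) ∈ F (m + 1) := by
          refine Finset.mem_filter.2 ⟨Finset.mk_mem_product (hπN _ t) (hπN m t), fun y hy => ?_⟩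
          have h1 := abs_le.1 (hπ (m + 1) t y hy)
          have h2 := abs_le.1 (hπ m t y hy)
          have h3 : R * (1 / 2 : ℝ) ^ (m + 1) = R * (1 / 2) ^ m / 2 := by rw [pow_succ]; ring
          simp only [g, Nat.succ_ne_zero, if_false]
          rw [mul_assoc, h3, abs_le]
          rw [h3] at h1
          constructor <;> linarith [h1.1, h1.2, h2.1, h2.2]
        have h1 := hlink (m + 1) _ hmem
        have h2 := blockDeviation_add_le (P := P) blk (fun i => X i ω) (hfint (π m t))
          ((hfint (π (m + 1) t)).sub (hfint (π m t)))
        simp only [Pi.sub_apply, add_sub_cancel] at h2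
        rw [Finset.sum_range_succ]
        simp only [g, Nat.succ_ne_zero, if_false] at h1
        exact h2.trans (add_le_add ih h1)
    have hthr : ∀ m, ∑ j ∈ Finset.range (m + 1), (3 / 4 : ℝ) ^ j / 4 * u ≤ u := by
      intro m
      rw [← Finset.sum_mul, ← Finset.sum_div, geom_sum_eq (by norm_num)]
      have : 0 ≤ (3 / 4 : ℝ) ^ (m + 1) := by positivity
      have h1 : ((3 / 4 : ℝ) ^ (m + 1) - 1) / (3 / 4 - 1) / 4 ≤ 1 := by
        rw [div_div, div_le_one_of_neg (by norm_num)]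
        linarith
      exact mul_le_of_le_one_left hu h1
    have hlim : Filter.Tendsto
        (fun m : ℕ => u + 2 * Fintype.card ι * (R * (1 / 2) ^ m)) Filter.atTop (nhds u) := by
      have := tendsto_pow_atTop_nhds_zero_of_lt_one (r := (1 / 2 : ℝ)) (by norm_num) (by norm_num)
      simpa using ((this.const_mul R).const_mul (2 * (Fintype.card ι : ℝ))).const_add u
    refine ge_of_tendsto' hlim fun m => ?_
    have h1 := blockDeviation_le_of_abs_le blk (fun i => X i ω)
      (h := fun y => f t y - f (π m t) y) hD (hπ m t) hω
    have h2 := blockDeviation_add_le (P := P) blk (fun i => X i ω) (hfint (π m t))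
      ((hfint t).sub (hfint (π m t)))
    simp only [Pi.sub_apply, add_sub_cancel] at h2
    exact h2.trans (add_le_add ((htel m).trans (hthr m)) h1)
  have hfinal : μ {ω | ¬ ∀ t, blockDeviation P blk (fun i => X i ω) (f t) ≤ u} ≤
      ENNReal.ofReal (Real.exp (-L)) := by
    refine (measure_mono_ae ?_).trans hBadU
    filter_upwards [hXD] with ω hω hbad
    by_contra hcon
    exact hbad (hgood ω hω hcon)
  exact ENNReal.toReal_le_of_le_ofReal (Real.exp_pos _).le hfinal

/-! ### The sample median -/

theorem apply_sort_mono {L : ℕ} (v : Fin L → ℝ) {i j : Fin L} (h : i ≤ j) :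
    v (Tuple.sort v i) ≤ v (Tuple.sort v j) := Tuple.monotone_sort v h

/-- If fewer than half of the values are farther than `ε` from `q`, so is neither of the two
middle values. -/
theorem abs_sampleMedian_sub_le {L : ℕ} (v : Fin L → ℝ) (q ε : ℝ)
    (h : 2 * (Finset.univ.filter fun ℓ => ε < |v ℓ - q|).card < L) :
    |sampleMedian v - q| ≤ ε := by
  have hL : 0 < L := by omega
  -- if the value at a middle position `m` is too large (small), then so are the values at all
  -- later (earlier) positions, which are at least half of them
  have key : ∀ m : Fin L, L ≤ 2 * (m : ℕ) + 2 → 2 * (m : ℕ) ≤ L →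
      |v (Tuple.sort v m) - q| ≤ ε := by
    intro m hm1 hm2
    by_contra hcon
    rw [abs_le, not_and_or, not_le, not_le] at hcon
    rcases hcon with hlow | hhigh
    · have hsub : (Finset.Iic m).map (Tuple.sort v).toEmbedding ⊆
          Finset.univ.filter fun ℓ => ε < |v ℓ - q| := by
        intro ℓ hℓ
        obtain ⟨j, hj, rfl⟩ := Finset.mem_map.1 hℓ
        have := apply_sort_mono v (Finset.mem_Iic.1 hj)
        refine Finset.mem_filter.2 ⟨Finset.mem_univ _, lt_abs.2 (Or.inr ?_)⟩
        simp only [Equiv.coe_toEmbedding]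
        linarith
      have := Finset.card_le_card hsub
      rw [Finset.card_map, Fin.card_Iic] at this
      omega
    · have hsub : (Finset.Ici m).map (Tuple.sort v).toEmbedding ⊆
          Finset.univ.filter fun ℓ => ε < |v ℓ - q| := by
        intro ℓ hℓ
        obtain ⟨j, hj, rfl⟩ := Finset.mem_map.1 hℓ
        have := apply_sort_mono v (Finset.mem_Ici.1 hj)
        refine Finset.mem_filter.2 ⟨Finset.mem_univ _, lt_abs.2 (Or.inl ?_)⟩
        simp only [Equiv.coe_toEmbedding]
        linarith
      have := Finset.card_le_card hsub
      rw [Finset.card_map, Fin.card_Ici] at this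
      omega
  have h1 := abs_le.1 (key ⟨(L - 1) / 2, by omega⟩ (by simp only; omega) (by simp only; omega))
  have h2 := abs_le.1 (key ⟨L / 2, by omega⟩ (by simp only; omega) (by simp only; omega))
  rw [sampleMedian, dif_pos hL, abs_le]
  constructor <;> linarith [h1.1, h1.2, h2.1, h2.2]

/-! ### The Bregman divergence and the clustering loss -/

/-- The tangent-plane inequality for convex functions. -/
theorem bregmanDiv_nonneg {p : ℕ} {φ : EuclideanSpace ℝ (Fin p) → ℝ} (hφ : Differentiable ℝ φ)
    (hconv : ConvexOn ℝ Set.univ φ) (x y : EuclideanSpace ℝ (Fin p)) : 0 ≤ bregmanDiv φ x y := by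
  have hc : ConvexOn ℝ Set.univ (fun t : ℝ => φ (AffineMap.lineMap y x t)) := by
    simpa [Function.comp_def] using hconv.comp_affineMap (AffineMap.lineMap y x : ℝ →ᵃ[ℝ] _)
  have hd : HasDerivAt (fun t : ℝ => φ (AffineMap.lineMap y x t))
      (inner ℝ (gradient φ y) (x - y)) 0 := by
    have h1 : HasFDerivAt φ (fderiv ℝ φ y) (AffineMap.lineMap y x (0 : ℝ)) := by
      simpa using (hφ y).hasFDerivAt
    have h2 := h1.comp_hasDerivAt (0 : ℝ) (AffineMap.hasDerivAt_lineMap (a := y) (b := x))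
    have h3 : inner ℝ (gradient φ y) (x - y) = fderiv ℝ φ y (x - y) := by
      simp [gradient]
    rw [h3]
    exact h2
  have := hc.le_slope_of_hasDerivAt (Set.mem_univ 0) (Set.mem_univ 1) one_pos hd
  simp only [slope_def_field, AffineMap.lineMap_apply_zero, AffineMap.lineMap_apply_one, sub_zero,
    div_one] at this
  unfold bregmanDiv
  linarith

theorem bregmanDiv_le_inner {p : ℕ} {φ : EuclideanSpace ℝ (Fin p) → ℝ} (hφ : Differentiable ℝ φ)
    (hconv : ConvexOn ℝ Set.univ φ) (x y : EuclideanSpace ℝ (Fin p)) :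
    bregmanDiv φ x y ≤ inner ℝ (gradient φ x - gradient φ y) (x - y) := by
  have h := bregmanDiv_nonneg hφ hconv y x
  have h2 : inner ℝ (gradient φ x) (y - x) = -inner ℝ (gradient φ x) (x - y) := by
    rw [← inner_neg_right, neg_sub]
  unfold bregmanDiv at *
  rw [inner_sub_left]
  linarith

theorem bregmanDiv_sub_bregmanDiv {p : ℕ} (φ : EuclideanSpace ℝ (Fin p) → ℝ)
    (x y z : EuclideanSpace ℝ (Fin p)) :
    bregmanDiv φ x y - bregmanDiv φ x z =
      bregmanDiv φ z y + inner ℝ (gradient φ z - gradient φ y) (x - z) := by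
  unfold bregmanDiv
  have : x - y = (x - z) + (z - y) := by abel
  rw [inner_sub_left, this, inner_add_right]
  ring

theorem norm_sub_le_of_forall_abs_le {p : ℕ} {x y : EuclideanSpace ℝ (Fin p)} {r : ℝ}
    (hr : 0 ≤ r) (h : ∀ i, |x i - y i| ≤ r) : ‖x - y‖ ≤ √p * r := by
  rw [EuclideanSpace.norm_eq]
  apply Real.sqrt_le_iff.2 ⟨by positivity, ?_⟩
  rw [mul_pow, Real.sq_sqrt (by positivity)]
  calc ∑ i, ‖(x - y) i‖ ^ 2 ≤ ∑ _i : Fin p, r ^ 2 := by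
        refine Finset.sum_le_sum fun i _ => ?_
        have := h i
        simp only [PiLp.sub_apply, Real.norm_eq_abs]
        gcongr
    _ = p * r ^ 2 := by simp

theorem norm_sub_le_of_mem_box {p : ℕ} {M : ℝ} (hM : 0 ≤ M) {x y : EuclideanSpace ℝ (Fin p)}
    (hx : x ∈ box p M) (hy : y ∈ box p M) : ‖x - y‖ ≤ √p * (2 * M) := by
  refine norm_sub_le_of_forall_abs_le (by linarith) fun i => ?_
  have h1 := hx i
  have h2 := hy i
  rw [abs_le]
  constructor <;> linarith [h1.1, h1.2, h2.1, h2.2]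

section Box

variable {p : ℕ} {M H : ℝ} {φ : EuclideanSpace ℝ (Fin p) → ℝ}

theorem bregmanDiv_le_mul_norm_sq (hφ : Differentiable ℝ φ) (hconv : ConvexOn ℝ Set.univ φ)
    (hgrad : ∀ x ∈ box p M, ∀ y ∈ box p M, ‖gradient φ x - gradient φ y‖ ≤ H * ‖x - y‖)
    {x y : EuclideanSpace ℝ (Fin p)} (hx : x ∈ box p M) (hy : y ∈ box p M) :
    bregmanDiv φ x y ≤ H * ‖x - y‖ ^ 2 := by
  refine (bregmanDiv_le_inner hφ hconv x y).trans ((real_inner_le_norm _ _).trans ?_)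
  rw [pow_two, ← mul_assoc]
  exact mul_le_mul_of_nonneg_right (hgrad x hx y hy) (norm_nonneg _)

theorem bregmanDiv_le_of_mem_box (hM : 0 ≤ M) (hH : 0 ≤ H) (hφ : Differentiable ℝ φ)
    (hconv : ConvexOn ℝ Set.univ φ)
    (hgrad : ∀ x ∈ box p M, ∀ y ∈ box p M, ‖gradient φ x - gradient φ y‖ ≤ H * ‖x - y‖)
    {x y : EuclideanSpace ℝ (Fin p)} (hx : x ∈ box p M) (hy : y ∈ box p M) :
    bregmanDiv φ x y ≤ 8 * H * M ^ 2 * p := by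
  refine (bregmanDiv_le_mul_norm_sq hφ hconv hgrad hx hy).trans ?_
  calc H * ‖x - y‖ ^ 2 ≤ H * (√p * (2 * M)) ^ 2 := by
        gcongr; exact norm_sub_le_of_mem_box hM hx hy
    _ = 4 * (H * M ^ 2 * p) := by rw [mul_pow, Real.sq_sqrt (by positivity)]; ring
    _ ≤ 8 * (H * M ^ 2 * p) := by
        have : 0 ≤ H * M ^ 2 * p := by positivity
        linarith
    _ = _ := by ring

theorem bregmanDiv_sub_le (hM : 0 ≤ M) (hH : 0 ≤ H) (hφ : Differentiable ℝ φ)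
    (hconv : ConvexOn ℝ Set.univ φ)
    (hgrad : ∀ x ∈ box p M, ∀ y ∈ box p M, ‖gradient φ x - gradient φ y‖ ≤ H * ‖x - y‖)
    {x y z : EuclideanSpace ℝ (Fin p)} (hx : x ∈ box p M) (hy : y ∈ box p M) (hz : z ∈ box p M)
    {s : ℝ} (hs : 0 ≤ s) (h : ∀ i, |y i - z i| ≤ 2 * M * s) :
    bregmanDiv φ x y - bregmanDiv φ x z ≤ 8 * H * M ^ 2 * p * s := by
  have hyz : ‖z - y‖ ≤ √p * (2 * M * s) := by
    rw [norm_sub_rev]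
    exact norm_sub_le_of_forall_abs_le (by positivity) h
  have h1 := bregmanDiv_le_mul_norm_sq hφ hconv hgrad hz hy
  have h2 : inner ℝ (gradient φ z - gradient φ y) (x - z) ≤ H * ‖z - y‖ * (√p * (2 * M)) :=
    (real_inner_le_norm _ _).trans (mul_le_mul (hgrad z hz y hy) (norm_sub_le_of_mem_box hM hx hz)
      (norm_nonneg _) (by positivity))
  have h3 : H * ‖z - y‖ ^ 2 ≤ H * ‖z - y‖ * (√p * (2 * M)) := by
    rw [pow_two, ← mul_assoc]
    gcongr
    exact norm_sub_le_of_mem_box hM hz hy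
  have h4 : H * ‖z - y‖ * (√p * (2 * M)) ≤ H * (√p * (2 * M * s)) * (√p * (2 * M)) := by gcongr
  have h5 : H * (√p * (2 * M * s)) * (√p * (2 * M)) = 4 * (H * M ^ 2 * p * s) := by
    have := Real.mul_self_sqrt (Nat.cast_nonneg (α := ℝ) p)
    linear_combination (4 * H * M ^ 2 * s) * this
  rw [bregmanDiv_sub_bregmanDiv]
  linarith

theorem abs_bregmanDiv_sub_le (hM : 0 ≤ M) (hH : 0 ≤ H) (hφ : Differentiable ℝ φ)
    (hconv : ConvexOn ℝ Set.univ φ)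
    (hgrad : ∀ x ∈ box p M, ∀ y ∈ box p M, ‖gradient φ x - gradient φ y‖ ≤ H * ‖x - y‖)
    {x y z : EuclideanSpace ℝ (Fin p)} (hx : x ∈ box p M) (hy : y ∈ box p M) (hz : z ∈ box p M)
    {s : ℝ} (hs : 0 ≤ s) (h : ∀ i, |y i - z i| ≤ 2 * M * s) :
    |bregmanDiv φ x y - bregmanDiv φ x z| ≤ 8 * H * M ^ 2 * p * s := by
  refine abs_le.2 ⟨?_, bregmanDiv_sub_le hM hH hφ hconv hgrad hx hy hz hs h⟩
  have := bregmanDiv_sub_le hM hH hφ hconv hgrad hx hz hy hs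
    fun i => by rw [abs_sub_comm]; exact h i
  linarith

variable {k : ℕ} {τ : ℝ} {Ψ : (Fin k → ℝ) → ℝ}

theorem abs_clusterLoss_sub_le (hM : 0 ≤ M) (hH : 0 ≤ H) (hτ : 0 ≤ τ) (hφ : Differentiable ℝ φ)
    (hconv : ConvexOn ℝ Set.univ φ)
    (hgrad : ∀ x ∈ box p M, ∀ y ∈ box p M, ‖gradient φ x - gradient φ y‖ ≤ H * ‖x - y‖)
    (hΨ : ∀ x y, 0 ≤ x → 0 ≤ y → |Ψ x - Ψ y| ≤ τ * ∑ j, |x j - y j|)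
    {Θ Θ' : Fin k → EuclideanSpace ℝ (Fin p)} (hΘ : Θ ∈ centroidBox k p M)
    (hΘ' : Θ' ∈ centroidBox k p M) {x : EuclideanSpace ℝ (Fin p)} (hx : x ∈ box p M)
    {s : ℝ} (hs : 0 ≤ s) (h : ∀ j i, |Θ j i - Θ' j i| ≤ 2 * M * s) :
    |clusterLoss Ψ φ Θ x - clusterLoss Ψ φ Θ' x| ≤ 8 * (M ^ 2 * τ * H * (k * p)) * s := by
  refine (hΨ _ _ (fun j => bregmanDiv_nonneg hφ hconv _ _)
    (fun j => bregmanDiv_nonneg hφ hconv _ _)).trans ?_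
  calc _ ≤ τ * ∑ _j : Fin k, 8 * H * M ^ 2 * p * s := by
        gcongr with j
        exact abs_bregmanDiv_sub_le hM hH hφ hconv hgrad hx (hΘ j) (hΘ' j) hs (h j)
    _ = _ := by simp; ring

theorem abs_clusterLoss_le (hM : 0 ≤ M) (hH : 0 ≤ H) (hτ : 0 ≤ τ) (hφ : Differentiable ℝ φ)
    (hconv : ConvexOn ℝ Set.univ φ)
    (hgrad : ∀ x ∈ box p M, ∀ y ∈ box p M, ‖gradient φ x - gradient φ y‖ ≤ H * ‖x - y‖)
    (hΨ0 : Ψ 0 = 0) (hΨ : ∀ x y, 0 ≤ x → 0 ≤ y → |Ψ x - Ψ y| ≤ τ * ∑ j, |x j - y j|)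
    {Θ : Fin k → EuclideanSpace ℝ (Fin p)} (hΘ : Θ ∈ centroidBox k p M)
    {x : EuclideanSpace ℝ (Fin p)} (hx : x ∈ box p M) :
    |clusterLoss Ψ φ Θ x| ≤ 8 * (M ^ 2 * τ * H * (k * p)) := by
  have h := hΨ (fun j => bregmanDiv φ x (Θ j)) 0 (fun j => bregmanDiv_nonneg hφ hconv _ _) le_rfl
  rw [hΨ0, sub_zero] at h
  refine h.trans ?_
  calc _ ≤ τ * ∑ _j : Fin k, 8 * H * M ^ 2 * p := by
        gcongr with j
        rw [Pi.zero_apply, sub_zero, abs_of_nonneg (bregmanDiv_nonneg hφ hconv _ _)]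
        exact bregmanDiv_le_of_mem_box hM hH hφ hconv hgrad hx (hΘ j)
    _ = _ := by simp; ring

theorem continuous_clusterLoss (hφ : Differentiable ℝ φ) (hconv : ConvexOn ℝ Set.univ φ)
    (hΨ : ∀ x y, 0 ≤ x → 0 ≤ y → |Ψ x - Ψ y| ≤ τ * ∑ j, |x j - y j|)
    (Θ : Fin k → EuclideanSpace ℝ (Fin p)) : Continuous (clusterLoss Ψ φ Θ) := by
  have hd : ∀ y, Continuous fun x => bregmanDiv φ x y := fun y => by
    have := hφ.continuous
    unfold bregmanDiv
    fun_prop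
  refine continuous_iff_continuousAt.2 fun x => ?_
  have hlim : Filter.Tendsto
      (fun z => τ * ∑ j, |bregmanDiv φ z (Θ j) - bregmanDiv φ x (Θ j)|) (nhds x) (nhds 0) := by
    have hc : Continuous fun z => τ * ∑ j, |bregmanDiv φ z (Θ j) - bregmanDiv φ x (Θ j)| := by
      fun_prop
    simpa using hc.tendsto x
  refine tendsto_iff_dist_tendsto_zero.2 (squeeze_zero (fun _ => dist_nonneg) (fun z => ?_) hlim)
  exact hΨ _ _ (fun j => bregmanDiv_nonneg hφ hconv _ _) (fun j => bregmanDiv_nonneg hφ hconv _ _)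

end Box

/-! ### Grids of centroids -/

theorem exists_grid_point_near {M x : ℝ} (hM : 0 < M) (hx : x ∈ Set.Icc (-M) M) {N : ℕ}
    (hN : 0 < N) : ∃ j : Fin (N + 1), |x - (-M + 2 * M * (j / N))| ≤ 2 * M * (1 / N) := by
  have hN' : (0 : ℝ) < N := by exact_mod_cast hN
  set y : ℝ := (x + M) / (2 * M) * N with hy
  have hy0 : 0 ≤ y := by
    have : 0 ≤ x + M := by linarith [hx.1]
    positivity
  have hyN : y ≤ N := by
    have : (x + M) / (2 * M) ≤ 1 := by rw [div_le_one (by positivity)]; linarith [hx.2]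
    calc y ≤ 1 * N := by rw [hy]; gcongr
      _ = N := one_mul _
  have hfl : ⌊y⌋₊ ≤ N := Nat.floor_le_of_le hyN
  refine ⟨⟨⌊y⌋₊, by omega⟩, ?_⟩
  have h1 := Nat.floor_le hy0
  have h2 := (Nat.lt_floor_add_one y).le
  have h3 : x - (-M + 2 * M * ((⌊y⌋₊ : ℝ) / N)) = 2 * M * ((y - ⌊y⌋₊) / N) := by
    rw [hy]; field_simp; ring
  simp only
  rw [h3, abs_of_nonneg (mul_nonneg (by positivity) (div_nonneg (by linarith) hN'.le))]
  gcongr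
  linarith

/-- A grid of mesh `2 M / N` in each of the `k p` coordinates. -/
theorem exists_finset_centroidBox_net {k p : ℕ} {M : ℝ} (hM : 0 < M) {N : ℕ} (hN : 0 < N) :
    ∃ G : Finset (centroidBox k p M), G.card ≤ (N + 1) ^ (k * p) ∧
      ∀ Θ : centroidBox k p M, ∃ Θ' ∈ G, ∀ j i, |Θ.1 j i - Θ'.1 j i| ≤ 2 * M * (1 / N) := by
  classical
  have hN' : (0 : ℝ) < N := by exact_mod_cast hN
  let g : (Fin k → Fin p → Fin (N + 1)) → centroidBox k p M := fun J =>
    ⟨fun j => WithLp.toLp 2 fun i => -M + 2 * M * (((J j i : ℕ) : ℝ) / N), by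
      intro j i
      have h1 : ((J j i : ℕ) : ℝ) / N ≤ 1 := by
        rw [div_le_one hN']
        exact_mod_cast Nat.lt_succ_iff.1 (J j i).2
      have h0 : 0 ≤ ((J j i : ℕ) : ℝ) / N := by positivity
      constructor
      · simp only [le_add_iff_nonneg_right]; positivity
      · simp only; nlinarith⟩
  refine ⟨Finset.univ.image g, ?_, fun Θ => ?_⟩
  · refine Finset.card_image_le.trans (le_of_eq ?_)
    simp [pow_mul, mul_comm k p]
  · choose J hJ using fun j i => exists_grid_point_near hM (Θ.2 j i) hN
    exact ⟨g J, Finset.mem_image_of_mem _ (Finset.mem_univ _), hJ⟩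

/-! ### From block deviations to the median of means -/

/-- A block without outliers whose mean is off by more than `ε` contributes more than `b ε` to the
summed deviations, so that there are at most `c L` of them; the outliers spoil at most `O.card`
further blocks. -/
theorem abs_medianOfMeans_sub_integral_le {n L b : ℕ} {E : Type*} [MeasurableSpace E]
    {P : Measure E} {B : Fin L → Finset (Fin n)} (hb : 0 < b) (hB : IsBlockPartition B b)
    {blk : Fin n → Fin L} (hblk : ∀ i ℓ, i ∈ B ℓ ↔ blk i = ℓ) (O : Finset (Fin n))
    {f : E → ℝ} {x : Fin n → E} {c ε : ℝ} (hε : 0 < ε)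
    (hdev : blockDeviation P (fun i : {i // i ∉ O} => blk i) (fun i => x i) f ≤ c * L * b * ε)
    (hcount : 2 * (O.card + c * L) < L) :
    |medianOfMeans B b f x - ∫ y, f y ∂P| ≤ ε := by
  classical
  have hb' : (0 : ℝ) < b := by exact_mod_cast hb
  set q := ∫ y, f y ∂P with hq
  set G : Finset (Fin L) := Finset.univ.filter fun ℓ =>
    (∀ i ∈ B ℓ, i ∉ O) ∧ ε < |(1 / (b : ℝ)) * ∑ i ∈ B ℓ, f (x i) - q| with hG
  have hGterm : ∀ ℓ ∈ G, b * ε ≤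
      |∑ i : {i // i ∉ O} with blk i.1 = ℓ, (f (x i.1) - q)| := by
    intro ℓ hℓ
    obtain ⟨-, hO, hlt⟩ := Finset.mem_filter.1 hℓ
    have hsum : ∑ i : {i // i ∉ O} with blk i.1 = ℓ, (f (x i.1) - q) =
        ∑ i ∈ B ℓ, (f (x i) - q) := by
      refine Finset.sum_bij (fun i _ => i.1) ?_ ?_ ?_ ?_
      · intro i hi
        exact (hblk _ _).2 (Finset.mem_filter.1 hi).2
      · intro i _ j _ hij
        exact Subtype.ext hij
      · intro i hi
        exact ⟨⟨i, hO i hi⟩, by simpa using (hblk _ _).1 hi, rfl⟩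
      · intro i _
        rfl
    have hmean : ∑ i ∈ B ℓ, (f (x i) - q) =
        b * ((1 / (b : ℝ)) * ∑ i ∈ B ℓ, f (x i) - q) := by
      rw [Finset.sum_sub_distrib, Finset.sum_const, hB.card_eq, nsmul_eq_mul]
      field_simp
    rw [hsum, hmean, abs_mul, abs_of_pos hb']
    gcongr
  have hGcard : (G.card : ℝ) ≤ c * L := by
    have h1 : G.card * (b * ε) ≤ c * L * (b * ε) :=
      calc (G.card : ℝ) * (b * ε) = ∑ _ℓ ∈ G, b * ε := by simp
        _ ≤ ∑ ℓ ∈ G, |∑ i : {i // i ∉ O} with blk i.1 = ℓ, (f (x i.1) - q)| :=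
          Finset.sum_le_sum hGterm
        _ ≤ blockDeviation P (fun i : {i // i ∉ O} => blk i) (fun i => x i) f :=
          Finset.sum_le_sum_of_subset_of_nonneg (Finset.subset_univ _) fun _ _ _ => abs_nonneg _
        _ ≤ c * L * (b * ε) := by rwa [← mul_assoc]
    exact le_of_mul_le_mul_right h1 (by positivity)
  refine abs_sampleMedian_sub_le _ _ _ ?_
  have hsub : (Finset.univ.filter fun ℓ =>
      ε < |(1 / (b : ℝ)) * ∑ i ∈ B ℓ, f (x i) - q|) ⊆ O.image blk ∪ G := by
    intro ℓ hℓ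
    by_cases hO : ∀ i ∈ B ℓ, i ∉ O
    · exact Finset.mem_union_right _ (Finset.mem_filter.2 ⟨Finset.mem_univ _, hO,
        (Finset.mem_filter.1 hℓ).2⟩)
    · push Not at hO
      obtain ⟨i, hi, hiO⟩ := hO
      exact Finset.mem_union_left _ (Finset.mem_image.2 ⟨i, hiO, (hblk _ _).1 hi⟩)
  have hcard := (Finset.card_le_card hsub).trans (Finset.card_union_le _ _)
  have himg : (O.image blk).card ≤ O.card := Finset.card_image_le
  have : 2 * ((O.card : ℝ) + G.card) < L := by linarith
  have : 2 * (O.card + G.card) < L := by exact_mod_cast this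
  omega

theorem IsBlockPartition.exists_block_index {n L b : ℕ} {B : Fin L → Finset (Fin n)}
    (hB : IsBlockPartition B b) : ∃ blk : Fin n → Fin L, ∀ i ℓ, i ∈ B ℓ ↔ blk i = ℓ := by
  choose blk hblk using hB.cover
  refine ⟨blk, fun i ℓ => ⟨fun hi => ?_, fun h => h ▸ hblk i⟩⟩
  by_contra hne
  exact Finset.disjoint_left.1 (hB.disjoint _ _ hne) (hblk i) hi

theorem IsBlockPartition.card_eq_mul {n L b : ℕ} {B : Fin L → Finset (Fin n)}
    (hB : IsBlockPartition B b) : n = L * b := by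
  obtain ⟨blk, hblk⟩ := hB.exists_block_index
  have h := Finset.card_eq_sum_card_fiberwise (s := Finset.univ) (t := Finset.univ) (f := blk)
    fun i _ => Finset.mem_coe.2 (Finset.mem_univ _)
  have h2 : ∀ ℓ, (Finset.univ.filter fun i => blk i = ℓ) = B ℓ := fun ℓ => by
    ext i; simp [hblk]
  simpa [h2, hB.card_eq] using h

/-- The loss vanishes on the cube and so does the scale `M² τ H k p` of the error bound, or all of
the quantities involved are positive. In the first case `τ` and `M` may have any sign. -/
theorem clusterLoss_eq_zero_or_pos {k p : ℕ} {M τ H : ℝ} {φ : EuclideanSpace ℝ (Fin p) → ℝ}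
    {Ψ : (Fin k → ℝ) → ℝ} (hφ : Differentiable ℝ φ) (hconv : ConvexOn ℝ Set.univ φ) (hH : 0 ≤ H)
    (hgrad : ∀ x ∈ box p M, ∀ y ∈ box p M, ‖gradient φ x - gradient φ y‖ ≤ H * ‖x - y‖)
    (hΨ0 : Ψ 0 = 0) (hΨ : ∀ x y, 0 ≤ x → 0 ≤ y → |Ψ x - Ψ y| ≤ τ * ∑ j, |x j - y j|)
    (hne : (box p M).Nonempty) :
    ((∀ Θ ∈ centroidBox k p M, ∀ x ∈ box p M, |clusterLoss Ψ φ Θ x| ≤ 0) ∧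
        M ^ 2 * τ * H * (k * p) = 0) ∨
      (0 < M ∧ 0 < τ ∧ 0 < H ∧ 0 < k ∧ 0 < p) := by
  rcases Nat.eq_zero_or_pos k with rfl | hk
  · refine Or.inl ⟨fun Θ _ x _ => ?_, by simp⟩
    rw [clusterLoss, Subsingleton.elim (fun j => bregmanDiv φ x (Θ j)) 0, hΨ0, abs_zero]
  rcases Nat.eq_zero_or_pos p with rfl | hp
  · refine Or.inl ⟨fun Θ _ x _ => ?_, by simp⟩
    have : (fun j => bregmanDiv φ x (Θ j)) = 0 := by
      funext j
      rw [Subsingleton.elim (Θ j) x]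
      simp [bregmanDiv]
    rw [clusterLoss, this, hΨ0, abs_zero]
  have hτ : 0 ≤ τ := by
    have h := (abs_nonneg _).trans (hΨ (fun _ => 1) 0 (fun _ => zero_le_one) le_rfl)
    have hk' : (0 : ℝ) < k := by exact_mod_cast hk
    simp only [Pi.zero_apply, sub_zero, abs_one, Finset.sum_const, Finset.card_univ,
      Fintype.card_fin, nsmul_eq_mul, mul_one] at h
    exact nonneg_of_mul_nonneg_left h hk'
  have hM : 0 ≤ M := by
    obtain ⟨x, hx⟩ := hne
    have := hx ⟨0, hp⟩
    linarith [this.1, this.2]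
  rcases eq_or_ne (M ^ 2 * τ * H * (k * p)) 0 with h0 | h0
  · refine Or.inl ⟨fun Θ hΘ x hx => ?_, h0⟩
    have := abs_clusterLoss_le hM hH hτ hφ hconv hgrad hΨ0 hΨ hΘ hx
    rwa [h0, mul_zero] at this
  · have hM0 : M ≠ 0 := by rintro rfl; simp at h0
    have hτ0 : τ ≠ 0 := by rintro rfl; simp at h0
    have hH0 : H ≠ 0 := by rintro rfl; simp at h0
    exact Or.inr ⟨hM.lt_of_ne' hM0, hτ.lt_of_ne' hτ0, hH.lt_of_ne' hH0, hk, hp⟩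

theorem one_sub_measureReal_not_le {Ω : Type*} [MeasurableSpace Ω] {μ : Measure Ω}
    [IsProbabilityMeasure μ] (A : Set Ω) : 1 - μ.real Aᶜ ≤ μ.real A := by
  have h := measureReal_union_le (μ := μ) A Aᶜ
  rw [Set.union_compl_self, probReal_univ] at h
  linarith

/-- The two branches of the maximum dominate the two terms of the chaining condition, here for loss
bound `8 K` and threshold `400 n ε`, where `ε = a max(…)`; the constants fit because
`1152 * 8² ≤ 400² / 2`. -/
theorem chaining_condition_of_max {d N n L a K : ℝ} (hd : 0 < d) (hN : 0 ≤ N) (hn : 0 < n)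
    (hL : 0 ≤ L) (hNn : N ≤ n) (hK : K = a * d) :
    1152 * N * (8 * K) ^ 2 * (L + d) ≤
      (400 * n * (a * max (d * √(L / n)) (d ^ (3 / 2 : ℝ) * (√N / n)))) ^ 2 := by
  set m := max (d * √(L / n)) (d ^ (3 / 2 : ℝ) * (√N / n)) with hm
  have h1 : d ^ 2 * (L / n) ≤ m ^ 2 := by
    calc d ^ 2 * (L / n) = (d * √(L / n)) ^ 2 := by rw [mul_pow, Real.sq_sqrt (by positivity)]
      _ ≤ m ^ 2 := by gcongr; exact le_max_left _ _
  have h2 : d ^ 3 * (N / n ^ 2) ≤ m ^ 2 := by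
    have h3 : (d ^ (3 / 2 : ℝ)) ^ 2 = d ^ 3 := by
      rw [← Real.rpow_natCast, ← Real.rpow_mul hd.le, ← Real.rpow_natCast]
      norm_num
    calc d ^ 3 * (N / n ^ 2) = (d ^ (3 / 2 : ℝ) * (√N / n)) ^ 2 := by
          rw [mul_pow, h3, div_pow, Real.sq_sqrt hN]
      _ ≤ m ^ 2 := by gcongr; exact le_max_right _ _
  have h1' : (a * d) ^ 2 * (N * L) ≤ (n * a * m) ^ 2 := by
    calc (a * d) ^ 2 * (N * L) ≤ (a * d) ^ 2 * (n * L) := by gcongr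
      _ = (n * a) ^ 2 * (d ^ 2 * (L / n)) := by field_simp
      _ ≤ (n * a) ^ 2 * m ^ 2 := by gcongr
      _ = _ := by ring
  have h2' : (a * d) ^ 2 * (N * d) ≤ (n * a * m) ^ 2 := by
    calc (a * d) ^ 2 * (N * d) = (n * a) ^ 2 * (d ^ 3 * (N / n ^ 2)) := by field_simp
      _ ≤ (n * a) ^ 2 * m ^ 2 := by gcongr
      _ = _ := by ring
  have h0 : 0 ≤ (n * a * m) ^ 2 := sq_nonneg _
  calc 1152 * N * (8 * K) ^ 2 * (L + d)
      = 73728 * ((a * d) ^ 2 * (N * L) + (a * d) ^ 2 * (N * d)) := by rw [hK]; ring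
    _ ≤ 160000 * (n * a * m) ^ 2 := by linarith
    _ = _ := by ring

theorem mainTheorem1 (η : ℝ) (hη : 0 < η) :
    ∃ C : ℝ, 0 < C ∧
      ∀ (k p n L b : ℕ) (M τ H : ℝ)
        -- the Bregman generator
        (φ : EuclideanSpace ℝ (Fin p) → ℝ) (_ : Differentiable ℝ φ) (_ : ConvexOn ℝ Set.univ φ)
        (_ : 0 ≤ H)
        (_ : ∀ x ∈ box p M, ∀ y ∈ box p M, ‖gradient φ x - gradient φ y‖ ≤ H * ‖x - y‖)
        -- the aggregating function, on the non-negative orthant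
        (Ψ : (Fin k → ℝ) → ℝ) (_ : ∀ x, 0 ≤ x → 0 ≤ Ψ x) (_ : Ψ 0 = 0)
        (_ : ∀ x y, 0 ≤ x → x ≤ y → Ψ x ≤ Ψ y)
        (_ : ∀ x y, 0 ≤ x → 0 ≤ y → |Ψ x - Ψ y| ≤ τ * ∑ j, |x j - y j|)
        -- the law of the inliers
        (P : Measure (EuclideanSpace ℝ (Fin p))) (_ : IsProbabilityMeasure P)
        (_ : P (box p M) = 1)
        -- the sample, with outlier indices `O` and inlier indices `Oᶜ`
        (Ω : Type*) (_ : MeasurableSpace Ω) (μ : Measure Ω) (_ : IsProbabilityMeasure μ)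
        (X : Fin n → Ω → EuclideanSpace ℝ (Fin p)) (_ : ∀ i, Measurable (X i))
        (O : Finset (Fin n))
        (_ : iIndepFun (fun i : {i // i ∉ O} => X i) μ)
        (_ : ∀ i, i ∉ O → μ.map (X i) = P)
        -- the blocks
        (B : Fin L → Finset (Fin n)) (_ : 0 < b) (_ : IsBlockPartition B b)
        (_ : (2 + η) * (O.card : ℝ) < (L : ℝ)),
        1 - 2 * Real.exp (-2 * (L : ℝ) * (2 / (4 + η) - (O.card : ℝ) / (L : ℝ)) ^ 2) ≤
          μ.real {ω |
            (⨆ Θ ∈ centroidBox k p M,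
              ((|medianOfMeans B b (clusterLoss Ψ φ Θ) (fun i => X i ω)
                  - ∫ x, clusterLoss Ψ φ Θ x ∂P| : ℝ) : EReal)) ≤
            ((C * M ^ 2 * τ * H *
                max ((k : ℝ) * (p : ℝ) * √((L : ℝ) / (n : ℝ)))
                  (((k : ℝ) * (p : ℝ)) ^ (3 / 2 : ℝ) * (√(Oᶜ.card : ℝ) / (n : ℝ))) : ℝ) :
              EReal)} := by
  -- `c` is the fraction of blocks that may fail without spoiling the median
  set c : ℝ := η / (2 * (2 + η)) with hc
  have hcpos : 0 < c := by positivity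
  refine ⟨400 / c, by positivity, ?_⟩
  intro k p n L b M τ H φ hφ hconv hH hgrad Ψ _ hΨ0 _ hΨ P hP hPbox Ω _ μ hμ X hXm O hind hlaw
    B hb hB hO
  obtain ⟨blk, hblk⟩ := hB.exists_block_index
  have hn : n = L * b := hB.card_eq_mul
  have hO0 : (0 : ℝ) ≤ O.card := Nat.cast_nonneg _
  have hL : (0 : ℝ) < L := lt_of_le_of_lt (by positivity) hO
  have hLn : 0 < L := by exact_mod_cast hL
  have hnpos : 0 < n := hn ▸ Nat.mul_pos hLn hb
  have hnpos' : (0 : ℝ) < n := by exact_mod_cast hnpos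
  have hbpos' : (0 : ℝ) < b := by exact_mod_cast hb
  have hncast : (n : ℝ) = L * b := by exact_mod_cast hn
  have hOfrac : (O.card : ℝ) / L < 1 / (2 + η) := by
    rw [div_lt_div_iff₀ hL (by positivity)]
    linarith
  have hcount : 2 * ((O.card : ℝ) + c * L) < L := by
    have h1 : (O.card : ℝ) < 1 / (2 + η) * L := (div_lt_iff₀ hL).1 hOfrac
    have h2 : 2 * (1 / (2 + η) * L + c * L) = L := by rw [hc]; field_simp
    linarith
  have hOn : O.card < n := by
    have h1 : (O.card : ℝ) < L := by nlinarith
    have h2 : O.card < L := by exact_mod_cast h1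
    have h3 : L ≤ n := hn ▸ Nat.le_mul_of_pos_right L hb
    omega
  have hcardι : Fintype.card {i // i ∉ O} = Oᶜ.card := by
    rw [Fintype.card_subtype]
    congr 1
    ext i
    simp
  have hcardpos : 0 < Fintype.card {i // i ∉ O} := by
    rw [hcardι, Finset.card_compl, Fintype.card_fin]
    omega
  have hD : ∀ᵐ y ∂P, y ∈ box p M := by
    have hbox : MeasurableSet (box p M) := by
      have : box p M = ⋂ i, (fun x : EuclideanSpace ℝ (Fin p) => x i) ⁻¹' Set.Icc (-M) M := by
        ext x
        simp [box]
      rw [this]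
      exact MeasurableSet.iInter fun i => measurableSet_Icc.preimage (by fun_prop)
    exact (prob_compl_eq_zero_iff hbox).2 hPbox
  have hlaw' : ∀ i : {i // i ∉ O}, μ.map (X i) = P := fun i => hlaw i i.2
  -- `δ ≤ 1 / 2`, so that a failure probability of `exp (-L)` is more than enough
  have hexp : Real.exp (-L) ≤
      2 * Real.exp (-2 * (L : ℝ) * (2 / (4 + η) - (O.card : ℝ) / (L : ℝ)) ^ 2) := by
    have h1 : 2 / (4 + η) ≤ 1 / 2 := by
      rw [div_le_div_iff₀ (by positivity) (by norm_num)]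
      linarith
    have h2 : 1 / (2 + η) ≤ 1 / 2 := by
      rw [div_le_div_iff₀ (by positivity) (by norm_num)]
      linarith
    have h3 : 0 ≤ (O.card : ℝ) / L := by positivity
    have h4 : 0 ≤ 2 / (4 + η) := by positivity
    have h5 : (2 / (4 + η) - (O.card : ℝ) / (L : ℝ)) ^ 2 ≤ (1 / 2) ^ 2 :=
      sq_le_sq' (by linarith) (by linarith)
    have h6 : Real.exp (-L) ≤
        Real.exp (-2 * (L : ℝ) * (2 / (4 + η) - (O.card : ℝ) / (L : ℝ)) ^ 2) :=
      Real.exp_le_exp.2 (by nlinarith)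
    linarith [Real.exp_pos (-2 * (L : ℝ) * (2 / (4 + η) - (O.card : ℝ) / (L : ℝ)) ^ 2)]
  simp only [iSup_le_iff, EReal.coe_le_coe_iff]
  rcases clusterLoss_eq_zero_or_pos hφ hconv hH hgrad hΨ0 hΨ hD.exists with
    ⟨hzero, hK⟩ | ⟨hM, hτ, hHpos, hk, hp⟩
  · have hrhs : ∀ C s t : ℝ, C * M ^ 2 * τ * H *
        max ((k : ℝ) * p * s) (((k : ℝ) * p) ^ (3 / 2 : ℝ) * t) = 0 := by
      intro C s t
      rcases mul_eq_zero.1 hK with h | h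
      · linear_combination
          (C * max ((k : ℝ) * p * s) (((k : ℝ) * p) ^ (3 / 2 : ℝ) * t)) * h
      · rw [h, Real.zero_rpow (by norm_num), zero_mul, zero_mul, max_self, mul_zero]
    have hXD : ∀ᵐ ω ∂μ, ∀ i : {i // i ∉ O}, X i ω ∈ box p M := by
      refine ae_all_iff.2 fun i => ?_
      have := hD
      rw [← hlaw' i] at this
      exact ae_of_ae_map (hXm i).aemeasurable this
    refine (one_sub_measureReal_not_le _).trans' ?_
    refine (sub_le_sub_left (b := 0) ?_ 1).trans' (by linarith [Real.exp_pos (-L : ℝ)])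
    refine le_of_eq ((measureReal_eq_zero_iff).2 ?_)
    filter_upwards [hXD] with ω hω Θ hΘ
    rw [hrhs]
    -- the claimed bound is `0` here, and the counting of blocks needs a positive `ε`
    refine le_of_forall_pos_le_add fun ε hε => ?_
    rw [zero_add]
    refine abs_medianOfMeans_sub_integral_le hb hB hblk O hε ?_ hcount
    refine (blockDeviation_le_of_abs_le _ _ hD (hzero Θ hΘ) hω).trans ?_
    rw [mul_zero]
    positivity
  · set mx := max ((k : ℝ) * (p : ℝ) * √((L : ℝ) / (n : ℝ)))
      (((k : ℝ) * (p : ℝ)) ^ (3 / 2 : ℝ) * (√(Oᶜ.card : ℝ) / (n : ℝ))) with hmx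
    have hkp : (0 : ℝ) < (k : ℝ) * p := by
      have : (0 : ℝ) < k := by exact_mod_cast hk
      have : (0 : ℝ) < p := by exact_mod_cast hp
      positivity
    have hmxpos : 0 < mx := lt_of_lt_of_le (by positivity) (le_max_left _ _)
    set K : ℝ := M ^ 2 * τ * H * (k * p) with hK
    have hKpos : 0 < K := by positivity
    have hcond : 1152 * (Fintype.card {i // i ∉ O} : ℝ) * (8 * K) ^ 2 * (L + (k * p : ℕ)) ≤
        (400 * n * (M ^ 2 * τ * H * mx)) ^ 2 := by
      rw [hcardι, hmx]
      push_cast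
      refine chaining_condition_of_max hkp (Nat.cast_nonneg _) hnpos' hL.le ?_ hK
      exact_mod_cast (Finset.card_le_univ _).trans (by simp)
    have hchain := measureReal_not_forall_blockDeviation_le (T := centroidBox k p M)
      (fun i : {i // i ∉ O} => hXm i) hind hlaw' (fun i => blk i) hcardpos hD
      (R := 8 * K) (by positivity) (by positivity) hcond (f := fun Θ => clusterLoss Ψ φ Θ.1)
      (fun Θ => (continuous_clusterLoss hφ hconv hΨ Θ.1).measurable)
      (fun Θ y hy => abs_clusterLoss_le hM.le hH hτ.le hφ hconv hgrad hΨ0 hΨ Θ.2 hy)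
      (fun m => by
        obtain ⟨G, hGcard, hG⟩ := exists_finset_centroidBox_net (k := k) (p := p) hM
          (N := 2 ^ m) (by positivity)
        refine ⟨G, hGcard, fun Θ => ?_⟩
        obtain ⟨Θ', hΘ', hnear⟩ := hG Θ
        refine ⟨Θ', hΘ', fun y hy => ?_⟩
        refine abs_clusterLoss_sub_le hM.le hH hτ.le hφ hconv hgrad hΨ Θ.2 Θ'.2 hy
          (by positivity) fun j i => ?_
        simpa using hnear j i)
    refine (one_sub_measureReal_not_le _).trans' (sub_le_sub_left (le_trans ?_ hexp) 1)
    refine (measureReal_mono ?_ (measure_ne_top _ _)).trans hchain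
    intro ω hω hall
    refine hω fun Θ hΘ => ?_
    refine abs_medianOfMeans_sub_integral_le hb hB hblk O (c := c) (by positivity)
      ((hall ⟨Θ, hΘ⟩).trans (le_of_eq ?_)) hcount
    rw [hncast]
    field_simp
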